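/- **Theorem 1.5.** Let $d\ge 1$, and let $A\subseteq\mathbb{R}_{\ge 0}$ be a set with at least two elements. Let $E$ be the set of nearest neighbour edges of $\mathbb{Z}^d$, and equip the space of configurations $\Omega=A^{E}$ with the product topology, where $A$ has the subspace topology. For $\omega\in\Omega$, the passage time $\tau_\omega(\Gamma)$ of a finite lattice path $\Gamma$ is the sum of $\omega(e)$ over its edges $e$. For $x,y\in\mathbb{R}^d$ put $T_\omega(x,y)=\inf_\Gamma\tau_\omega(\Gamma)$, the infimum over the lattice paths $\Gamma$ from $x'$ to $y'$, where $x',y'\in\mathbb{Z}^d$ are the lattice points with $x\in x'+[0,1)^d$ and $y\in y'+[0,1)^d$. For $t\ge 0$ let $B(t)=B_\omega(t)=\{x\in\mathbb{R}^d : T_\omega(0,x)\le t\}$. Let $D_r$ be the closed $\ell_1$ ball of radius $r$ centered at $0$ in $\mathbb{R}^d$, with the conventions $D_0=\{0\}$, $D_\infty=\mathbb{R}^d$, $\frac1\infty=0$ and $\frac10=\infty$. Let $\mathcal{K}_A^d$ be the set of connected compact sets $K\subseteq\mathbb{R}^d$ with $D_{1/\sup A}\subseteq K\subseteq D_{1/\inf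 A}$. Let $\mathcal{P}_A^d$ be the set of those $K\in\mathcal{K}_A^d$ for which there is an $\alpha>0$ such that for each $x\in K$ there is a topological path in $K$ from $0$ to $x$ of $\ell_1$-length at most $\frac{1}{\inf A}-\alpha$ (no restriction on the length if $\inf A=0$). Let $\overline{\mathcal{P}_A^d}$ be the closure of $\mathcal{P}_A^d$ in $\mathcal{K}_A^d$ with respect to the Hausdorff metric. Assume that $\inf A=0$ or $\sup A=\infty$. Then there is a residual subset $R$ of $\Omega$ such that for every $\omega\in R$ and every $K\in\overline{\mathcal{P}_A^d}$ there exists a sequence $(t_n)_{n=1}^\infty$ of positive reals tending to infinity with $$\frac{B_\omega(t_n)}{t_n}\to K$$ in the Hausdorff metric. -/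

import Mathlib

open Filter Topology TopologicalSpace
open scoped NNReal ENNReal Pointwise

noncomputable section

namespace FPP

/-- `ℝ^d` with the `ℓ¹` norm (the topology is the usual one). -/
abbrev Space (d : ℕ) : Type := PiLp 1 (fun _ : Fin d => ℝ)

/-- The nearest neighbour graph on `ℤ^d`: two lattice points are joined by an edge iff their
`ℓ¹` distance is `1`. -/
def lattice (d : ℕ) : SimpleGraph (Fin d → ℤ) where
  Adj x y := ∑ i, |x i - y i| = 1
  symm := ⟨fun x y h => by simpa only [abs_sub_comm] using h⟩
  loopless := ⟨fun x h => by simp at h⟩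

/-- The space `Ω = A^E` of configurations, where `E` is the set of nearest neighbour edges;
it carries the product topology, each factor `A` having the subspace topology. -/
abbrev Config (d : ℕ) (A : Set ℝ≥0) : Type := (lattice d).edgeSet → A

variable {d : ℕ} {A : Set ℝ≥0}

/-- The passage time of a finite path of consecutive edges: the sum of the passage times of its
edges. -/
def pathTime (ω : Config d A) {x y : Fin d → ℤ} (p : (lattice d).Walk x y) : ℝ≥0 :=
  (p.darts.map fun δ => (ω ⟨δ.edge, δ.edge_mem⟩ : ℝ≥0)).sum

/-- The unique lattice point `x'` with `x ∈ x' + [0,1)^d`. -/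
def latticePoint (x : Space d) : Fin d → ℤ := fun i => ⌊x i⌋

/-- `T(x,y)`: the infimum of the passage times of the paths from `x'` to `y'`. -/
def T (ω : Config d A) (x y : Space d) : ℝ≥0∞ :=
  ⨅ p : (lattice d).Walk (latticePoint x) (latticePoint y), (pathTime ω p : ℝ≥0∞)

/-- `B(t)`, for `t ≥ 0`: the ball of radius `t` around the origin in the pseudometric `T`. -/
def B (ω : Config d A) (t : ℝ) : Set (Space d) := {x | T ω 0 x ≤ ENNReal.ofReal t}

/-- `inf A`. -/
def infA (A : Set ℝ≥0) : ℝ≥0∞ := ⨅ a ∈ A, (a : ℝ≥0∞)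

/-- `sup A`, equal to `∞` if `A` is unbounded. -/
def supA (A : Set ℝ≥0) : ℝ≥0∞ := ⨆ a ∈ A, (a : ℝ≥0∞)

/-- The closed `ℓ¹` ball of radius `r ∈ [0,∞]` around `0`: it is `{0}` for `r = 0` and the whole
space for `r = ∞`. -/
def D (d : ℕ) (r : ℝ≥0∞) : Set (Space d) := {x | ‖x‖ₑ ≤ r}

/-- `𝒦_A^d`: the connected compact sets `K` with `D_{1 / sup A} ⊆ K ⊆ D_{1 / inf A}`, where
`1 / ∞ = 0` and `1 / 0 = ∞` in `[0,∞]`. -/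
def KSet (d : ℕ) (A : Set ℝ≥0) : Set (NonemptyCompacts (Space d)) :=
  {K | IsConnected (K : Set (Space d)) ∧
    D d (supA A)⁻¹ ⊆ (K : Set (Space d)) ∧ (K : Set (Space d)) ⊆ D d (infA A)⁻¹}

/-- The `ℓ¹` length of a topological path. -/
def pathLength {x y : Space d} (γ : Path x y) : ℝ≥0∞ := eVariationOn γ Set.univ

/-- `𝒫_A^d`: the sets `K ∈ 𝒦_A^d` for which some `α > 0` is such that every `x ∈ K` is the endpoint
of a topological path in `K` from `0` of `ℓ¹` length at most `1 / inf A - α`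
(no restriction on the length if `inf A = 0`). -/
def PSet (d : ℕ) (A : Set ℝ≥0) : Set (NonemptyCompacts (Space d)) :=
  {K | K ∈ KSet d A ∧ ∃ α : ℝ≥0, 0 < α ∧ ∀ x ∈ K, ∃ γ : Path (0 : Space d) x,
    Set.range γ ⊆ (K : Set (Space d)) ∧ pathLength γ + α ≤ (infA A)⁻¹}

/-- The closure of `𝒫_A^d` in `𝒦_A^d` with respect to the Hausdorff metric (the metric that
`NonemptyCompacts` carries). -/
def PClosure (d : ℕ) (A : Set ℝ≥0) : Set (NonemptyCompacts (Space d)) :=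
  KSet d A ∩ closure (PSet d A)

end FPP

end

/-!
Fix `K ∈ PSet d A`. The configurations `ω` for which `t⁻¹ • B ω t` is close to `K` at some large
time `t` contain a dense open set; intersecting over a countable dense subset of `PSet d A` and over
the tolerances `1 / (n + 1)` gives a residual set that serves all of `PClosure d A`.

For density, prescribe `ω` on a finite set `F` of edges. Off `F`, the edges in a thin tube around
`t • K` that lie outside the ball of radius `R` get a value close to `infA A`, and all other edges a
high value.

* Every point of `t • K` is reached in time. Up to the tolerance one only has to reach a finite net,
  along finite chains in `K` with small steps (`exists_chain`), followed by straight lattice walks.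
  Erasing loops makes a walk use each edge of `F` at most once, so that `F` costs a bounded amount
  (`exists_walk_pathTime_le`), negligible compared with `t`.
* The ball does not leave the tube by much. A potential whose increments are bounded by the edge
  times bounds passage times from below (`sub_le_pathTime`, `infDist_le_of_mem_B`). It becomes
  constant far from `t • K`, so only finitely many edges matter and the estimate is stable on a
  neighbourhood of `ω`.

If `supA A = ⊤`, take `R = 0` and high edges costing more than `t`. If `supA A` is finite, then
`infA A = 0`. In this case `K` contains the ball of radius `(supA A)⁻¹`, and `R` is chosen slightly
below `t * (supA A)⁻¹`: nearly all of the time passes before the radius `R` is exceeded, after which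
the tube is crossed almost for free, while too little time is left to get far out of it.
-/

/-! ### Lattice points in space, straight walks and reachability -/

namespace FPP

variable {d : ℕ} {A : Set ℝ≥0}

/-- The inclusion of `ℤ^d` into `ℝ^d`. -/
def emb (v : Fin d → ℤ) : Space d := WithLp.toLp 1 fun i => (v i : ℝ)

lemma norm_emb_sub_emb (u v : Fin d → ℤ) : ‖emb u - emb v‖ = ((∑ i, |u i - v i| : ℤ) : ℝ) := by
  rw [PiLp.norm_eq_of_L1]
  push_cast
  rfl

lemma norm_emb_sub_emb_of_adj {u v : Fin d → ℤ} (h : (lattice d).Adj u v) :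
    ‖emb u - emb v‖ = 1 := by
  have h' : ∑ i, |u i - v i| = 1 := h
  rw [norm_emb_sub_emb, h', Int.cast_one]

lemma norm_emb_latticePoint_sub_le (x : Space d) : ‖emb (latticePoint x) - x‖ ≤ d := by
  rw [PiLp.norm_eq_of_L1]
  calc _ ≤ ∑ _i : Fin d, (1 : ℝ) := by
        refine Finset.sum_le_sum fun i _ => ?_
        change |(⌊x i⌋ : ℝ) - x i| ≤ 1
        rw [abs_le]
        constructor <;> linarith [Int.floor_le (x i), Int.lt_floor_add_one (x i)]
    _ = d := by simp

lemma latticePoint_zero : latticePoint (0 : Space d) = 0 := by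
  funext i
  simp [latticePoint]

lemma emb_zero : emb (0 : Fin d → ℤ) = 0 := by
  ext i
  simp [emb]

lemma norm_emb_latticePoint_sub_emb_latticePoint_le (x y : Space d) :
    ‖emb (latticePoint x) - emb (latticePoint y)‖ ≤ ‖x - y‖ + 2 * d := by
  have hx := norm_emb_latticePoint_sub_le x
  have hy := norm_emb_latticePoint_sub_le y
  have h : emb (latticePoint x) - emb (latticePoint y) =
      (emb (latticePoint x) - x) + (x - y) - (emb (latticePoint y) - y) := by abel
  rw [h]
  refine (norm_sub_le _ _).trans ?_
  linarith [norm_add_le (emb (latticePoint x) - x) (x - y)]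

lemma finite_setOf_norm_emb_le (N : ℝ) : {v : Fin d → ℤ | ‖emb v‖ ≤ N}.Finite := by
  refine (Set.finite_Icc (fun _ => -⌈N⌉) (fun _ => ⌈N⌉)).subset fun v hv => ?_
  have h (i : Fin d) : |v i| ≤ ⌈N⌉ := by
    have h1 : ‖(emb v).ofLp i‖ ≤ N := (PiLp.norm_apply_le (emb v) i).trans hv
    have h2 : ((|v i| : ℤ) : ℝ) ≤ ⌈N⌉ := by
      push_cast
      exact h1.trans (Int.le_ceil N)
    exact_mod_cast h2
  exact ⟨fun i => (abs_le.1 (h i)).1, fun i => (abs_le.1 (h i)).2⟩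

lemma finite_setOf_edge_norm_le (N : ℝ) :
    {e : (lattice d).edgeSet | ∀ v ∈ (e : Sym2 (Fin d → ℤ)), ‖emb v‖ ≤ N}.Finite := by
  have h := (((finite_setOf_norm_emb_le (d := d) N).prod (finite_setOf_norm_emb_le N)).image
    fun p => s(p.1, p.2))
  refine (h.preimage Subtype.val_injective.injOn).subset ?_
  rintro ⟨e, he⟩ hN
  induction e using Sym2.ind with
  | _ u v => exact ⟨(u, v), ⟨hN u (by simp), hN v (by simp)⟩, rfl⟩

lemma exists_walk_length_le (u v : Fin d → ℤ) :
    ∃ p : (lattice d).Walk u v, (p.length : ℝ) ≤ ‖emb u - emb v‖ := by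
  suffices H : ∀ n : ℕ, ∀ u : Fin d → ℤ, ∑ i, |u i - v i| = n →
      ∃ p : (lattice d).Walk u v, p.length = n by
    have h0 : 0 ≤ ∑ i, |u i - v i| := Finset.sum_nonneg fun i _ => abs_nonneg _
    obtain ⟨p, hp⟩ := H (∑ i, |u i - v i|).toNat u (by omega)
    refine ⟨p, ?_⟩
    rw [norm_emb_sub_emb, hp]
    exact_mod_cast (Int.toNat_of_nonneg h0).le
  intro n
  induction n with
  | zero =>
    intro u hu
    have h : u = v := by
      funext i
      have := (Finset.sum_eq_zero_iff_of_nonneg fun i _ => abs_nonneg (u i - v i)).1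
        (by simpa using hu) i (Finset.mem_univ i)
      linarith [abs_eq_zero.1 this]
    subst h
    exact ⟨.nil, rfl⟩
  | succ n ih =>
    intro u hu
    obtain ⟨i, hi⟩ : ∃ i, u i ≠ v i := by
      by_contra! h
      simp only [h, sub_self, abs_zero, Finset.sum_const_zero] at hu
      omega
    obtain ⟨z, hz1, hz2⟩ : ∃ z : ℤ, |u i - z| = 1 ∧ |u i - v i| = |z - v i| + 1 := by
      rcases lt_or_gt_of_ne hi with h | h
      · refine ⟨u i + 1, by simp, ?_⟩
        rw [abs_of_nonpos (by omega), abs_of_nonpos (by omega)]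
        ring
      · refine ⟨u i - 1, by simp, ?_⟩
        rw [abs_of_nonneg (by omega), abs_of_nonneg (by omega)]
        ring
    have hsum (f : ℤ → ℤ → ℤ) (w : Fin d → ℤ) : ∑ j, f (Function.update u i z j) (w j) =
        f z (w i) + ∑ j ∈ Finset.univ.erase i, f (u j) (w j) := by
      rw [← Finset.add_sum_erase _ _ (Finset.mem_univ i), Function.update_self]
      congr 1
      refine Finset.sum_congr rfl fun j hj => ?_
      rw [Function.update_of_ne (Finset.ne_of_mem_erase hj)]
    have hadj : (lattice d).Adj u (Function.update u i z) := by
      refine SimpleGraph.Adj.symm ?_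
      change ∑ j, |Function.update u i z j - u j| = 1
      rw [hsum (fun a b => |a - b|) u, Finset.sum_eq_zero (by simp), abs_sub_comm, hz1, add_zero]
    obtain ⟨p, hp⟩ := ih (Function.update u i z) (by
      rw [hsum (fun a b => |a - b|) v]
      rw [← Finset.add_sum_erase _ _ (Finset.mem_univ i), hz2] at hu
      push_cast at hu
      linarith)
    exact ⟨.cons hadj p, by simp [hp]⟩

/-- A function whose increment over each edge is at most the passage time of that edge certifies a
lower bound for passage times. -/
lemma sub_le_pathTime (ω : Config d A) (φ : (Fin d → ℤ) → ℝ)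
    (hφ : ∀ u v (h : (lattice d).Adj u v),
      φ v - φ u ≤ (ω ⟨s(u, v), (SimpleGraph.mem_edgeSet _).2 h⟩ : ℝ≥0))
    {u v : Fin d → ℤ} (p : (lattice d).Walk u v) : φ v - φ u ≤ pathTime ω p := by
  induction p with
  | nil => simp [pathTime]
  | cons h p ih =>
    have h1 := hφ _ _ h
    simp only [pathTime, SimpleGraph.Walk.darts_cons, List.map_cons, List.sum_cons,
      NNReal.coe_add] at ih ⊢
    change _ ≤ ((ω ⟨s(_, _), _⟩ : ℝ≥0) : ℝ) + _
    linarith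

lemma norm_emb_sub_emb_le_length {u v w : Fin d → ℤ} (p : (lattice d).Walk u v)
    (hw : w ∈ p.support) : ‖emb w - emb u‖ ≤ p.length := by
  induction p with
  | nil => simp_all
  | @cons a b c h p ih =>
    rw [SimpleGraph.Walk.support_cons, List.mem_cons] at hw
    rw [SimpleGraph.Walk.length_cons, Nat.cast_add, Nat.cast_one]
    rcases hw with rfl | hw
    · rw [sub_self, norm_zero]
      positivity
    · have h1 := norm_sub_le_norm_sub_add_norm_sub (emb w) (emb b) (emb a)
      have h2 := norm_emb_sub_emb_of_adj h.symm
      linarith [ih hw]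

/-- Some lattice path from the lattice point of `x` to that of `y` has passage time at most `r`. -/
def Reach (ω : Config d A) (x y : Space d) (r : ℝ) : Prop :=
  ∃ p : (lattice d).Walk (latticePoint x) (latticePoint y), (pathTime ω p : ℝ) ≤ r

lemma Reach.mono {ω : Config d A} {x y : Space d} {r s : ℝ} (h : Reach ω x y r) (hrs : r ≤ s) :
    Reach ω x y s :=
  h.imp fun _ hp => hp.trans hrs

lemma Reach.refl (ω : Config d A) (x : Space d) : Reach ω x x 0 :=
  ⟨.nil, by simp [pathTime]⟩

lemma Reach.trans {ω : Config d A} {x y z : Space d} {r s : ℝ} (h : Reach ω x y r)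
    (h' : Reach ω y z s) : Reach ω x z (r + s) := by
  obtain ⟨p, hp⟩ := h
  obtain ⟨q, hq⟩ := h'
  refine ⟨p.append q, ?_⟩
  have : pathTime ω (p.append q) = pathTime ω p + pathTime ω q := by
    simp [pathTime, SimpleGraph.Walk.darts_append]
  rw [this, NNReal.coe_add]
  linarith

lemma Reach.mem_B {ω : Config d A} {x : Space d} {t : ℝ} (h : Reach ω 0 x t) : x ∈ B ω t := by
  obtain ⟨p, hp⟩ := h
  refine le_trans (iInf_le (fun p : (lattice d).Walk (latticePoint 0) (latticePoint x) =>
    (pathTime ω p : ℝ≥0∞)) p) ?_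
  rw [← ENNReal.ofReal_coe_nnreal]
  exact ENNReal.ofReal_le_ofReal hp

/-- A path without repeated vertices uses each edge of `F` at most once, so that the edges of `F`
contribute at most a constant to the passage time. -/
lemma exists_walk_pathTime_le (ω : Config d A) (F : Finset (lattice d).edgeSet)
    (c : (lattice d).edgeSet → ℝ) (hc : ∀ e, 0 ≤ c e) {l : ℝ} (hl : 0 ≤ l) {u v : Fin d → ℤ}
    (p : (lattice d).Walk u v)
    (hF : ∀ e ∈ F, (ω e : ℝ≥0) ≤ c e)
    (hp : ∀ e : (lattice d).edgeSet, (e : Sym2 _) ∈ p.edges → e ∉ F → (ω e : ℝ≥0) ≤ l) :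
    ∃ q : (lattice d).Walk u v, (pathTime ω q : ℝ) ≤ l * p.length + ∑ e ∈ F, c e := by
  classical
  refine ⟨p.bypass, ?_⟩
  set L : List (lattice d).edgeSet := p.bypass.darts.map fun δ => ⟨δ.edge, δ.edge_mem⟩ with hL
  have hLval : L.map Subtype.val = p.bypass.edges := by
    rw [hL, List.map_map]
    rfl
  have hnodup : L.Nodup := by
    apply List.Nodup.of_map Subtype.val
    rw [hLval]
    exact p.bypass_isPath.isTrail.edges_nodup
  have hlen : (L.length : ℝ) ≤ p.length := by
    rw [hL, List.length_map, SimpleGraph.Walk.length_darts]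
    exact_mod_cast p.length_bypass_le_length
  have htime : (pathTime ω p.bypass : ℝ) = ∑ e ∈ L.toFinset, ((ω e : ℝ≥0) : ℝ) := by
    rw [List.sum_toFinset _ hnodup, hL, List.map_map, pathTime, NNReal.coe_list_sum, List.map_map]
    rfl
  calc (pathTime ω p.bypass : ℝ)
      ≤ ∑ e ∈ L.toFinset, (l + if e ∈ F then c e else 0) := by
        rw [htime]
        refine Finset.sum_le_sum fun e he => ?_
        by_cases heF : e ∈ F
        · rw [if_pos heF]
          linarith [hF e heF]
        · rw [if_neg heF, add_zero]
          refine hp e (p.edges_bypass_subset_edges ?_) heF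
          rw [← hLval]
          exact List.mem_map_of_mem (List.mem_toFinset.1 he)
    _ = l * L.length + ∑ e ∈ L.toFinset ∩ F, c e := by
        rw [Finset.sum_add_distrib, Finset.sum_const, List.toFinset_card_of_nodup hnodup,
          Finset.sum_ite_mem, nsmul_eq_mul, mul_comm]
    _ ≤ l * p.length + ∑ e ∈ F, c e := by
        gcongr
        · exact fun e _ _ => hc e
        · exact Finset.inter_subset_right

/-- Travelling straight from `x` to `y`, when the edges near the starting point are fast. -/
lemma reach_of_fast_edges (ω : Config d A) (F : Finset (lattice d).edgeSet)
    (c : (lattice d).edgeSet → ℝ) (hc : ∀ e, 0 ≤ c e) {l r : ℝ} (hl : 0 ≤ l) {x y : Space d}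
    (hF : ∀ e ∈ F, (ω e : ℝ≥0) ≤ c e) (hxy : ‖x - y‖ + 2 * d ≤ r)
    (hp : ∀ e : (lattice d).edgeSet,
      (∀ v ∈ (e : Sym2 _), ‖emb v - emb (latticePoint x)‖ ≤ r) → e ∉ F → (ω e : ℝ≥0) ≤ l) :
    Reach ω x y (l * r + ∑ e ∈ F, c e) := by
  obtain ⟨p, hlen⟩ := exists_walk_length_le (latticePoint x) (latticePoint y)
  have hlen' : (p.length : ℝ) ≤ r :=
    hlen.trans ((norm_emb_latticePoint_sub_emb_latticePoint_le x y).trans hxy)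
  obtain ⟨q, hq⟩ := exists_walk_pathTime_le ω F c hc hl p hF fun e he heF =>
    hp e (fun v hv => (norm_emb_sub_emb_le_length p
      (SimpleGraph.Walk.mem_support_of_mem_edges he hv)).trans hlen') heF
  refine ⟨q, hq.trans ?_⟩
  gcongr

end FPP

/-! ### Chains of points, configurations and the lower bound -/

namespace FPP

variable {d : ℕ} {A : Set ℝ≥0}

lemma zero_mem_of_mem_KSet {K : NonemptyCompacts (Space d)} (hK : K ∈ KSet d A) :
    (0 : Space d) ∈ (K : Set (Space d)) :=
  hK.2.1 (by simp [D])

/-- The only consequence of membership in `PSet` that is used: every point of `K` is the end of a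
finite chain in `K` with small steps which a passage time close to `infA A` per unit length
traverses in time less than `1`. -/
lemma exists_chain (hA : A.Nonempty) {K : NonemptyCompacts (Space d)} (hK : K ∈ PSet d A)
    {x : Space d} (hx : x ∈ K) {δ : ℝ} (hδ : 0 < δ) :
    ∃ (m : ℕ) (y : ℕ → Space d), y 0 = 0 ∧ y m = x ∧ (∀ j, y j ∈ (K : Set (Space d))) ∧
      (∀ j < m, ‖y j - y (j + 1)‖ ≤ δ) ∧
      (infA A).toReal * ∑ j ∈ Finset.range m, ‖y j - y (j + 1)‖ < 1 := by
  obtain ⟨-, α, hα, hpath⟩ := hK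
  obtain ⟨γ, hγK, hγ⟩ := hpath x hx
  obtain ⟨η, hη, hηδ⟩ := Metric.uniformContinuous_iff.1
    (CompactSpace.uniformContinuous_of_continuous γ.continuous) δ hδ
  obtain ⟨n, hn⟩ := exists_nat_one_div_lt hη
  let u : ℕ → unitInterval := fun k => Set.projIcc 0 1 zero_le_one ((k : ℝ) / (n + 1))
  have hn0 : (0 : ℝ) < n + 1 := by positivity
  have hmono : Monotone u := fun a b hab => Set.monotone_projIcc _ (by gcongr)
  have hstep (k : ℕ) : dist (u k) (u (k + 1)) < η := by
    refine lt_of_le_of_lt ((LipschitzWith.projIcc zero_le_one).dist_le_mul _ _) ?_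
    rw [NNReal.coe_one, one_mul, Real.dist_eq, ← sub_div, abs_div, abs_of_pos hn0]
    simpa using hn
  have hsum : ∑ j ∈ Finset.range (n + 1), edist (γ (u (j + 1))) (γ (u j)) ≤ pathLength γ :=
    eVariationOn.sum_le hmono fun i => Set.mem_univ _
  refine ⟨n + 1, fun k => γ (u k), ?_, ?_, fun j => hγK ⟨_, rfl⟩, fun j _ => ?_, ?_⟩
  · simp [u]
  · simp only [u, Nat.cast_add, Nat.cast_one, div_self hn0.ne']
    simp
  · rw [← dist_eq_norm]
    exact (hηδ (hstep j)).le
  · have hreal : ENNReal.ofReal (∑ j ∈ Finset.range (n + 1), ‖γ (u j) - γ (u (j + 1))‖) ≤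
        pathLength γ := by
      rw [ENNReal.ofReal_sum_of_nonneg fun _ _ => norm_nonneg _]
      refine le_trans (Finset.sum_le_sum fun j _ => ?_) hsum
      rw [edist_dist, dist_comm, dist_eq_norm]
    set l := ∑ j ∈ Finset.range (n + 1), ‖γ (u j) - γ (u (j + 1))‖ with hl
    have hl0 : 0 ≤ l := Finset.sum_nonneg fun _ _ => norm_nonneg _
    rcases eq_or_ne (infA A) 0 with h0 | h0
    · simp [h0]
    have htop : infA A ≠ ⊤ := by
      obtain ⟨a, ha⟩ := hA
      exact ne_top_of_le_ne_top ENNReal.coe_ne_top (iInf₂_le a ha)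
    have hpos : 0 < (infA A).toReal := ENNReal.toReal_pos h0 htop
    have h1 : ENNReal.ofReal (l + α) ≤ (infA A)⁻¹ := by
      rw [ENNReal.ofReal_add hl0 α.coe_nonneg, ENNReal.ofReal_coe_nnreal]
      exact (add_le_add_left hreal _).trans hγ
    have h2 : l + α ≤ ((infA A).toReal)⁻¹ := by
      rw [← ENNReal.toReal_inv]
      exact (ENNReal.ofReal_le_iff_le_toReal (ENNReal.inv_ne_top.2 h0)).1 h1
    have h3 : (0 : ℝ) < α := hα
    calc _ < (infA A).toReal * (infA A).toReal⁻¹ := by gcongr; linarith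
      _ = 1 := mul_inv_cancel₀ hpos.ne'

/-- There is a configuration extending `ω₀` on `F` that is low on the edges with `P` and high on the
others, and this persists, on a finite set `I` of edges, in a neighbourhood. -/
lemma exists_config (ω₀ : Config d A) (F : Finset (lattice d).edgeSet)
    {I : Set (lattice d).edgeSet} (hI : I.Finite) (P : (lattice d).edgeSet → Prop) {lo hi : ℝ≥0}
    (hlo : lo ∈ A) (hhi : hi ∈ A) {l h : ℝ} (hl : lo < l) (hh : h < hi) :
    ∃ ω : Config d A, (∀ e ∈ F, ω e = ω₀ e) ∧ ∀ᶠ ω' in 𝓝 ω, ∀ e ∈ I,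
      (e ∈ F → ((ω' e : ℝ≥0) : ℝ) ≤ (ω₀ e : ℝ≥0) + 1) ∧
      (e ∉ F → P e → ((ω' e : ℝ≥0) : ℝ) ≤ l) ∧
      (e ∉ F → ¬ P e → h ≤ ((ω' e : ℝ≥0) : ℝ)) := by
  classical
  let ω : Config d A := fun e => if e ∈ F then ω₀ e else if P e then ⟨lo, hlo⟩ else ⟨hi, hhi⟩
  refine ⟨ω, fun e he => by simp [ω, he], ?_⟩
  rw [eventually_all_finite hI]
  intro e _
  have hcont : Tendsto (fun ω' : Config d A => ((ω' e : ℝ≥0) : ℝ)) (𝓝 ω)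
      (𝓝 ((ω e : ℝ≥0) : ℝ)) := by
    have : Continuous fun ω' : Config d A => ((ω' e : ℝ≥0) : ℝ) := by fun_prop
    exact this.tendsto ω
  by_cases heF : e ∈ F
  · have : ((ω e : ℝ≥0) : ℝ) < (ω₀ e : ℝ≥0) + 1 := by simp [ω, heF]
    filter_upwards [hcont.eventually_lt_const this] with ω' hω'
    exact ⟨fun _ => hω'.le, fun h => absurd heF h, fun h => absurd heF h⟩
  by_cases heP : P e
  · have : ((ω e : ℝ≥0) : ℝ) < l := by simpa [ω, heF, heP] using hl
    filter_upwards [hcont.eventually_lt_const this] with ω' hω'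
    exact ⟨fun h => absurd h heF, fun _ _ => hω'.le, fun _ h => absurd heP h⟩
  · have : h < ((ω e : ℝ≥0) : ℝ) := by simpa [ω, heF, heP] using hh
    filter_upwards [hcont.eventually_const_lt this] with ω' hω'
    exact ⟨fun h => absurd h heF, fun _ h => absurd h heP, fun _ _ => hω'.le⟩

/-- The edges with both endpoints at distance at most `w` from `K` and outside the open ball of
radius `R`. -/
def IsLow (K : Set (Space d)) (w R : ℝ) (e : (lattice d).edgeSet) : Prop :=
  ∀ v ∈ (e : Sym2 (Fin d → ℤ)), Metric.infDist (emb v) K ≤ w ∧ R ≤ ‖emb v‖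

/-- If the edges that are not low have passage time at least `h`, then crossing from radius `r₀` to
radius `R` and then from the `w`-neighbourhood of `K` to distance `s` of it takes a time of at
least `h` per unit length. Only finitely many edges are constrained. -/
lemma infDist_le_of_mem_B {ω : Config d A} {F : Finset (lattice d).edgeSet} {K : Set (Space d)}
    (hK : K.Nonempty) {M w R r₀ s h t : ℝ} (hM : ∀ z ∈ K, ‖z‖ ≤ M)
    (hr₀ : 0 ≤ r₀) (hR : 0 ≤ R) (hs : 0 < s) (hh : 0 ≤ h) (ht : 0 ≤ t)
    (hF : ∀ e ∈ F, ∀ v ∈ (e : Sym2 (Fin d → ℤ)), ‖emb v‖ ≤ r₀)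
    (hw₀ : ∀ z : Space d, ‖z‖ ≤ r₀ → Metric.infDist z K ≤ w)
    (hwR : ∀ z : Space d, ‖z‖ ≤ R + 1 → Metric.infDist z K ≤ w)
    (hω : ∀ e : (lattice d).edgeSet, (∀ v ∈ (e : Sym2 (Fin d → ℤ)), ‖emb v‖ ≤ M + w + s + 1) →
      e ∉ F → ¬ IsLow K w R e → h ≤ ((ω e : ℝ≥0) : ℝ))
    (hth : t < h * (max (R - r₀) 0 + s)) {x : Space d} (hx : x ∈ B ω t) :
    Metric.infDist x K ≤ w + s + d := by
  -- Across an edge of `F` or a low edge `φ` does not change. Across the others at most one of `φ₁`,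
  -- `φ₂` changes: `φ₁` only if an endpoint has norm less than `R`, and `φ₂` vanishes where the norm is
  -- at most `R + 1`.
  let g : (Fin d → ℤ) → ℝ := fun v => Metric.infDist (emb v) K
  let φ₁ : (Fin d → ℤ) → ℝ := fun v => max (min ‖emb v‖ R - r₀) 0
  let φ₂ : (Fin d → ℤ) → ℝ := fun v => min (max (g v - w) 0) s
  let φ : (Fin d → ℤ) → ℝ := fun v => h * (φ₁ v + φ₂ v)
  have h_zero : φ 0 = 0 := by
    have h1 : g 0 ≤ w := hw₀ _ (by rw [emb_zero, norm_zero]; exact hr₀)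
    have h2 : φ₁ 0 = 0 := by
      simp only [φ₁, emb_zero, norm_zero, min_eq_left hR]
      exact max_eq_right (by linarith)
    have h3 : φ₂ 0 = 0 := by
      simp only [φ₂]
      rw [max_eq_right (by linarith), min_eq_left hs.le]
    simp [φ, h2, h3]
  have h_low (v) (hv : g v ≤ w) : φ₂ v = 0 := by
    simp only [φ₂]
    rw [max_eq_right (by linarith), min_eq_left hs.le]
  have h_out (v) (hv : R ≤ ‖emb v‖) : φ₁ v = max (R - r₀) 0 := by
    simp only [φ₁]
    rw [min_eq_right hv]
  have h_far (v) (hv : w + s ≤ g v) : φ₁ v = max (R - r₀) 0 ∧ φ₂ v = s := by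
    constructor
    · refine h_out v ?_
      by_contra! hlt
      have : g v ≤ w := hwR _ (by linarith)
      linarith
    · simp only [φ₂]
      rw [min_eq_right]
      exact le_max_of_le_left (by linarith)
  have hgM (v) : ‖emb v‖ - M ≤ g v := by
    refine (Metric.le_infDist hK).2 fun y hy => ?_
    rw [dist_eq_norm]
    linarith [norm_sub_norm_le (emb v) y, hM y hy]
  have hφ : ∀ u v (huv : (lattice d).Adj u v),
      φ v - φ u ≤ (ω ⟨s(u, v), (SimpleGraph.mem_edgeSet _).2 huv⟩ : ℝ≥0) := by
    intro u v huv
    have hdist : ‖emb u - emb v‖ = 1 := norm_emb_sub_emb_of_adj huv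
    have hn1 : ‖emb u‖ ≤ ‖emb v‖ + 1 := by
      linarith [norm_sub_norm_le (emb u) (emb v)]
    have hn2 : ‖emb v‖ ≤ ‖emb u‖ + 1 := by
      linarith [norm_sub_norm_le (emb v) (emb u), norm_sub_rev (emb u) (emb v)]
    have hg2 : g v ≤ g u + 1 := by
      refine (Metric.infDist_le_infDist_add_dist (y := emb u)).trans_eq ?_
      rw [dist_comm, dist_eq_norm, hdist]
    set e : (lattice d).edgeSet := ⟨s(u, v), (SimpleGraph.mem_edgeSet _).2 huv⟩ with he
    have hu : u ∈ (e : Sym2 (Fin d → ℤ)) := by simp [he]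
    have hv : v ∈ (e : Sym2 (Fin d → ℤ)) := by simp [he]
    by_cases heF : e ∈ F
    · have hu' := hF e heF u hu
      have hv' := hF e heF v hv
      have h1 (z) (hz : ‖emb z‖ ≤ r₀) : φ₁ z = 0 :=
        max_eq_right (by linarith [min_le_left ‖emb z‖ R])
      simp only [φ]
      rw [h_low u (hw₀ _ hu'), h_low v (hw₀ _ hv'), h1 u hu', h1 v hv']
      simp
    by_cases hlow : IsLow K w R e
    · simp only [φ]
      rw [h_low u (hlow u hu).1, h_low v (hlow v hv).1, h_out u (hlow u hu).2,
        h_out v (hlow v hv).2]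
      simp
    by_cases hbox : ‖emb u‖ ≤ M + w + s + 1 ∧ ‖emb v‖ ≤ M + w + s + 1
    · have hωe : h ≤ ((ω e : ℝ≥0) : ℝ) := by
        refine hω e (fun z hz => ?_) heF hlow
        rcases Sym2.mem_iff.1 (show z ∈ s(u, v) from hz) with rfl | rfl
        exacts [hbox.1, hbox.2]
      have hb : φ₁ v + φ₂ v - (φ₁ u + φ₂ u) ≤ 1 := by
        by_cases hRR : R ≤ ‖emb u‖ ∧ R ≤ ‖emb v‖
        · rw [h_out u hRR.1, h_out v hRR.2]
          have : φ₂ v ≤ φ₂ u + 1 := by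
            simp only [φ₂]
            rw [← min_add_add_right, ← max_add_add_right]
            exact min_le_min (max_le_max (by linarith) (by linarith)) (by linarith)
          linarith
        · have hu' : ‖emb u‖ ≤ R + 1 := by
            by_contra! hlt
            exact hRR ⟨by linarith, by linarith⟩
          have hv' : ‖emb v‖ ≤ R + 1 := by
            by_contra! hlt
            exact hRR ⟨by linarith, by linarith⟩
          rw [h_low u (hwR _ hu'), h_low v (hwR _ hv')]
          have : φ₁ v ≤ φ₁ u + 1 := by
            simp only [φ₁]
            rw [← max_add_add_right, sub_add_eq_add_sub, ← min_add_add_right]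
            exact max_le_max (sub_le_sub_right (min_le_min hn2 (by linarith)) _) (by linarith)
          linarith
      calc φ v - φ u = h * (φ₁ v + φ₂ v - (φ₁ u + φ₂ u)) := by simp only [φ]; ring
        _ ≤ h * 1 := by gcongr
        _ ≤ _ := by rwa [mul_one]
    · have hfar : M + w + s ≤ ‖emb u‖ ∧ M + w + s ≤ ‖emb v‖ := by
        by_contra hcon
        refine hbox ?_
        rcases not_and_or.1 hcon with hlt | hlt <;> exact ⟨by linarith, by linarith⟩
      obtain ⟨hu1, hu2⟩ := h_far u (by linarith [hgM u])
      obtain ⟨hv1, hv2⟩ := h_far v (by linarith [hgM v])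
      simp only [φ]
      rw [hu1, hu2, hv1, hv2]
      simp
  by_contra! hlt
  have hv : w + s ≤ g (latticePoint x) := by
    have h1 : Metric.infDist x K ≤ g (latticePoint x) + dist x (emb (latticePoint x)) :=
      Metric.infDist_le_infDist_add_dist
    rw [dist_comm, dist_eq_norm] at h1
    linarith [norm_emb_latticePoint_sub_le x]
  obtain ⟨hv1, hv2⟩ := h_far _ hv
  have h1 : ENNReal.ofReal (φ (latticePoint x)) ≤ T ω 0 x := by
    refine le_iInf fun p => ?_
    have := sub_le_pathTime ω φ hφ p
    have h0 : φ (latticePoint 0) = 0 := by rw [latticePoint_zero, h_zero]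
    rw [h0, sub_zero] at this
    exact (ENNReal.ofReal_le_ofReal this).trans_eq ENNReal.ofReal_coe_nnreal
  have h2 : φ (latticePoint x) ≤ t :=
    (ENNReal.ofReal_le_ofReal_iff ht).1 (h1.trans hx)
  simp only [φ, hv1, hv2] at h2
  linarith

/-- Passage times add up along a chain of points. From a point of norm at most `ρ` the chain is not
followed: the next point is reached directly from the origin. -/
lemma reach_chain {ω : Config d A} {y : ℕ → Space d} {t q l ρ C C' : ℝ} (hq : 0 ≤ q)
    (hl : 0 ≤ l) (ht : 0 ≤ t) (hC : 0 ≤ C) (hC' : 0 ≤ C') (hy : y 0 = 0) (m : ℕ)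
    (hdir : ∀ j < m, ‖y j‖ ≤ ρ → Reach ω 0 (t • y (j + 1)) (t * q + C'))
    (hstep : ∀ j < m, ρ < ‖y j‖ →
      Reach ω (t • y j) (t • y (j + 1)) (l * (t * ‖y j - y (j + 1)‖) + C)) :
    Reach ω 0 (t • y m)
      (t * (q + l * ∑ j ∈ Finset.range m, ‖y j - y (j + 1)‖) + (C' + m * C)) := by
  induction m with
  | zero =>
    rw [hy, smul_zero]
    refine (Reach.refl ω 0).mono ?_
    simp only [Finset.range_zero, Finset.sum_empty, Nat.cast_zero]
    positivity
  | succ m ih =>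
    rcases le_or_gt ‖y m‖ ρ with hm | hm
    · refine (hdir m m.lt_succ_self hm).mono ?_
      have h1 : 0 ≤ l * ∑ j ∈ Finset.range (m + 1), ‖y j - y (j + 1)‖ := by positivity
      have h2 : 0 ≤ ((m + 1 : ℕ) : ℝ) * C := by positivity
      nlinarith
    · refine ((ih (fun j hj => hdir j (by omega)) fun j hj => hstep j (by omega)).trans
        (hstep m m.lt_succ_self hm)).mono (le_of_eq ?_)
      rw [Finset.sum_range_succ]
      push_cast
      ring

end FPP

/-! ### Prescribing the ball at one large time -/

namespace FPP

variable {d : ℕ} {A : Set ℝ≥0}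

lemma infDist_smul_le {K : Set (Space d)} {t : ℝ} {y : Space d}
    (hy : y ∈ K) (z : Space d) : Metric.infDist z (t • K) ≤ ‖z - t • y‖ := by
  rw [← dist_eq_norm]
  exact Metric.infDist_le_dist_of_mem (Set.smul_mem_smul_set hy)

/-- Prescription of the ball at time `t`. The parameters are: the tolerance `ε`, the step size `δ`
of the chains to the points of the finite net `X`, the bound `l` for low edges and `h` for the
others, the radius `R` inside which no edge is low, the allowed overshoot `s`, and the bound
`t * q + C'` for the time in which points of norm at most `ρ + δ` are reached directly. -/
lemma exists_config_hausdorffEDist_le {K : Set (Space d)} (hKc : IsCompact K)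
    (hK0 : (0 : Space d) ∈ K) (ω₀ : Config d A) (F : Finset (lattice d).edgeSet)
    {X : Set (Space d)} {m : Space d → ℕ} {y : Space d → ℕ → Space d}
    {ε δ r₀ l h t R s ρ q C' : ℝ} {lo hi : ℝ≥0} (hlo : lo ∈ A) (hhi : hi ∈ A) (hlol : lo < l)
    (hhhi : h < hi) (hh : 0 ≤ h) (ht : 0 < t) (hδ : 0 < δ) (hδε : 8 * δ ≤ ε) (hr₀ : 0 ≤ r₀)
    (hR : 0 ≤ R) (hs : 0 < s) (hq : 0 ≤ q) (hC' : 0 ≤ C')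
    (hF : ∀ e ∈ F, ∀ v ∈ (e : Sym2 (Fin d → ℤ)), ‖emb v‖ ≤ r₀)
    (hX : ∀ k ∈ K, ∃ x ∈ X, dist k x ≤ ε)
    (hy0 : ∀ x ∈ X, y x 0 = 0) (hym : ∀ x ∈ X, y x (m x) = x)
    (hyK : ∀ x ∈ X, ∀ j, y x j ∈ K)
    (hyδ : ∀ x ∈ X, ∀ j < m x, ‖y x j - y x (j + 1)‖ ≤ δ)
    (htd : 3 * d ≤ δ * t) (htr₀ : r₀ ≤ δ * t)
    (hRK : ∀ z : Space d, ‖z‖ ≤ R + 1 → Metric.infDist z (t • K) ≤ 2 * (δ * t))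
    (hth : t < h * (max (R - r₀) 0 + s)) (hsε : 2 * s ≤ ε * t)
    (hRρ : R = 0 ∨ R ≤ (ρ - 2 * δ) * t)
    (hdir : ∀ (ω : Config d A) (z : Space d), 0 ≤ ρ → ‖z‖ ≤ ρ + δ →
      Reach ω 0 (t • z) (t * q + C'))
    (hcost : ∀ x ∈ X, t * (q + l * ∑ j ∈ Finset.range (m x), ‖y x j - y x (j + 1)‖) +
      (C' + m x * (l * (2 * d) + ∑ e ∈ F, (((ω₀ e : ℝ≥0) : ℝ) + 1))) ≤ t) :
    ∃ ω : Config d A, (∀ e ∈ F, ω e = ω₀ e) ∧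
      ∀ᶠ ω' in 𝓝 ω, Metric.hausdorffEDist (t⁻¹ • B ω' t) K ≤ ENNReal.ofReal ε := by
  have hl : 0 ≤ l := lo.coe_nonneg.trans hlol.le
  obtain ⟨M, hM⟩ := (hKc.smul t).isBounded.exists_norm_le
  have htK : (t • K).Nonempty := ⟨t • 0, Set.smul_mem_smul_set hK0⟩
  set w := 2 * (δ * t) with hw
  have hδt : 0 < δ * t := by positivity
  have hgM (z : Space d) : ‖z‖ - M ≤ Metric.infDist z (t • K) := by
    refine (Metric.le_infDist htK).2 fun y hy => ?_
    rw [dist_eq_norm]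
    linarith [norm_sub_norm_le z y, hM y hy]
  obtain ⟨ω, hωF, hω⟩ := exists_config ω₀ F (finite_setOf_edge_norm_le (d := d) (M + w + s + 1))
    (IsLow (t • K) w R) hlo hhi hlol hhhi
  refine ⟨ω, hωF, hω.mono fun ω' hω' => ?_⟩
  have hFbox (e) (he : e ∈ F) : ((ω' e : ℝ≥0) : ℝ) ≤ (ω₀ e : ℝ≥0) + 1 := by
    refine (hω' e fun v hv => ?_).1 he
    have h0 := hgM 0
    rw [norm_zero] at h0
    have h1 := infDist_smul_le (t := t) hK0 0
    rw [smul_zero, sub_zero, norm_zero] at h1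
    linarith [hF e he v hv]
  have hlow (e) (he : e ∉ F) (hel : IsLow (t • K) w R e) : ((ω' e : ℝ≥0) : ℝ) ≤ l := by
    refine (hω' e fun v hv => ?_).2.1 he hel
    linarith [hgM (emb v), (hel v hv).1]
  refine Metric.hausdorffEDist_le_of_mem_edist ?_ ?_
  · -- the ball does not leave the neighbourhood of `K`
    rintro _ ⟨x, hx, rfl⟩
    have hx' : Metric.infDist x (t • K) ≤ w + s + d := by
      refine infDist_le_of_mem_B htK hM hr₀ hR hs hh ht.le hF (fun z hz => ?_) hRK
        (fun e he heF hel => (hω' e he).2.2 heF hel) hth hx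
      have h1 := infDist_smul_le (t := t) hK0 z
      rw [smul_zero, sub_zero] at h1
      linarith
    obtain ⟨_, ⟨k, hk, rfl⟩, hk'⟩ := (hKc.smul t).exists_infDist_eq_dist htK x
    refine ⟨k, hk, ?_⟩
    rw [edist_dist]
    refine ENNReal.ofReal_le_ofReal ?_
    have h1 : dist (t⁻¹ • x) k = t⁻¹ * dist x (t • k) := by
      rw [dist_eq_norm, dist_eq_norm, ← norm_smul_of_nonneg (by positivity), smul_sub,
        inv_smul_smul₀ ht.ne']
    change dist (t⁻¹ • x) k ≤ ε
    rw [h1, inv_mul_le_iff₀ ht]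
    rw [hk'] at hx'
    change dist x (t • k) ≤ _ at hx'
    have h2 : 8 * (δ * t) ≤ t * ε := by nlinarith
    linarith
  · -- the points of the net are reached in time
    intro k hk
    obtain ⟨x, hxX, hkx⟩ := hX k hk
    refine ⟨x, ⟨t • x, ?_, inv_smul_smul₀ ht.ne' x⟩, ?_⟩
    swap
    · rw [edist_dist]
      exact ENNReal.ofReal_le_ofReal hkx
    refine Reach.mem_B (Reach.mono ?_ (hcost x hxX))
    have hc (e) : 0 ≤ ((ω₀ e : ℝ≥0) : ℝ) + 1 := by positivity
    have hC : 0 ≤ l * (2 * d) + ∑ e ∈ F, (((ω₀ e : ℝ≥0) : ℝ) + 1) :=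
      add_nonneg (by positivity) (Finset.sum_nonneg fun e _ => hc e)
    have key := reach_chain (ω := ω') (ρ := ρ) (t := t) hq hl ht.le hC hC' (hy0 x hxX) (m x)
      (fun j hj hρ => hdir ω' _ ((norm_nonneg _).trans hρ) ?_) (fun j hj hρ => ?_)
    · rwa [hym x hxX] at key
    · linarith [hyδ x hxX j hj, norm_sub_norm_le (y x (j + 1)) (y x j),
        norm_sub_rev (y x (j + 1)) (y x j)]
    · have hnorm : ‖t • y x j - t • y x (j + 1)‖ = t * ‖y x j - y x (j + 1)‖ := by
        rw [← smul_sub, norm_smul_of_nonneg ht.le]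
      refine (reach_of_fast_edges ω' F _ hc (r := t * ‖y x j - y x (j + 1)‖ + 2 * d) hl hFbox
        (by rw [hnorm]) fun e he heF => hlow e heF fun v hv => ?_).mono (le_of_eq (by ring))
      have h1 := he v hv
      have h2 := norm_emb_latticePoint_sub_le (t • y x j)
      have h3 : ‖emb v - t • y x j‖ ≤ δ * t + 3 * d := by
        have := norm_sub_le_norm_sub_add_norm_sub (emb v) (emb (latticePoint (t • y x j)))
          (t • y x j)
        have : t * ‖y x j - y x (j + 1)‖ ≤ δ * t := by nlinarith [hyδ x hxX j hj]
        linarith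
      refine ⟨(infDist_smul_le (hyK x hxX j) _).trans (by linarith), ?_⟩
      rcases hRρ with hR0 | hRρ
      · rw [hR0]
        exact norm_nonneg _
      · have h4 : ‖t • y x j‖ = t * ‖y x j‖ := norm_smul_of_nonneg ht.le _
        have h5 : t * ρ ≤ t * ‖y x j‖ := by gcongr
        have h6 := norm_sub_norm_le (t • y x j) (emb v)
        rw [norm_sub_rev] at h6
        linarith

end FPP

/-! ### The two cases and the category argument -/

namespace FPP

variable {d : ℕ} {A : Set ℝ≥0}

lemma eventually_le_const_mul (c : ℝ) {k : ℝ} (hk : 0 < k) : ∀ᶠ t : ℝ in atTop, c ≤ k * t :=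
  (tendsto_id.const_mul_atTop hk).eventually_ge_atTop c

lemma exists_gt_forall_mul_lt {ι : Type*} {X : Set ι} (hX : X.Finite) {L : ι → ℝ} {a κ : ℝ}
    (h : ∀ x ∈ X, a * L x < κ) : ∃ l > a, ∀ x ∈ X, l * L x < κ := by
  have : ∀ᶠ l in 𝓝[>] a, ∀ x ∈ X, l * L x < κ := by
    rw [eventually_all_finite hX]
    intro x hx
    have hc : Continuous fun l : ℝ => l * L x := by fun_prop
    exact ((hc.tendsto a).eventually_lt_const (h x hx)).filter_mono nhdsWithin_le_nhds
  obtain ⟨l, hl, hla⟩ := (this.and self_mem_nhdsWithin).exists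
  exact ⟨l, hla, hl⟩

lemma exists_mem_lt_of_infA_lt (hA : A.Nonempty) {l : ℝ} (hl : (infA A).toReal < l) :
    ∃ lo ∈ A, ((lo : ℝ≥0) : ℝ) < l := by
  obtain ⟨a, ha⟩ := hA
  have htop : infA A ≠ ⊤ := ne_top_of_le_ne_top ENNReal.coe_ne_top (iInf₂_le a ha)
  obtain ⟨b, hb⟩ := iInf_lt_iff.1 ((ENNReal.lt_ofReal_iff_toReal_lt htop).2 hl)
  obtain ⟨hbA, hb⟩ := iInf_lt_iff.1 hb
  refine ⟨b, hbA, ?_⟩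
  simpa using (ENNReal.lt_ofReal_iff_toReal_lt ENNReal.coe_ne_top).1 hb

lemma exists_norm_emb_le (F : Finset (lattice d).edgeSet) :
    ∃ r₀ : ℝ, 0 ≤ r₀ ∧ ∀ e ∈ F, ∀ v ∈ (e : Sym2 (Fin d → ℤ)), ‖emb v‖ ≤ r₀ := by
  classical
  have h (e : Sym2 (Fin d → ℤ)) : ∃ r : ℝ, ∀ v ∈ e, ‖emb v‖ ≤ r := by
    induction e using Sym2.ind with
    | _ u v =>
      refine ⟨max ‖emb u‖ ‖emb v‖, fun w hw => ?_⟩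
      rcases Sym2.mem_iff.1 hw with rfl | rfl
      exacts [le_max_left _ _, le_max_right _ _]
  choose r hr using h
  obtain ⟨M, hM⟩ := (F.image fun e : (lattice d).edgeSet => r e).exists_le
  exact ⟨max M 0, le_max_right _ _, fun e he v hv =>
    ((hr e v hv).trans (hM _ (Finset.mem_image_of_mem _ he))).trans (le_max_left _ _)⟩

/-- If `A` is unbounded, the tube around `t • K` is walled off by edges that take more than the
whole available time. -/
lemma exists_config_of_supA_eq_top (hA : A.Nonempty) (hsup : supA A = ⊤)
    {K : NonemptyCompacts (Space d)} (hK : K ∈ PSet d A) (ω₀ : Config d A)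
    (F : Finset (lattice d).edgeSet) {ε : ℝ} (hε : 0 < ε) (n : ℕ) :
    ∃ ω : Config d A, (∀ e ∈ F, ω e = ω₀ e) ∧ ∀ᶠ ω' in 𝓝 ω, ∃ t : ℝ, n + 1 ≤ t ∧
      Metric.hausdorffEDist (t⁻¹ • B ω' t) (K : Set (Space d)) ≤ ENNReal.ofReal ε := by
  obtain ⟨r₀, hr₀, hF⟩ := exists_norm_emb_le F
  obtain ⟨X, hXK, hXfin, hX⟩ := K.isCompact.finite_cover_balls hε
  have hδ : 0 < ε / 8 := by positivity
  have hchain := fun (x : Space d) (hx : x ∈ X) => exists_chain hA hK (hXK hx) hδ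
  choose! m y hy0 hym hyK hyδ hyL using hchain
  obtain ⟨l, hal, hl⟩ := exists_gt_forall_mul_lt hXfin hyL
  obtain ⟨lo, hlo, hlol⟩ := exists_mem_lt_of_infA_lt hA hal
  obtain ⟨t, ⟨ht1, ht2, ht3, ht4, ht5⟩, ht6⟩ := ((((eventually_ge_atTop ((n : ℝ) + 1)).and
    ((eventually_le_const_mul (3 * d : ℝ) hδ).and ((eventually_le_const_mul r₀ hδ).and
    ((eventually_le_const_mul 1 hδ).and (eventually_le_const_mul 2 hε))))).and
    ((eventually_all_finite hXfin).2 fun x hx => eventually_le_const_mul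
      (m x * (l * (2 * d) + ∑ e ∈ F, (((ω₀ e : ℝ≥0) : ℝ) + 1))) (sub_pos.2 (hl x hx))))).exists
  have ht : 0 < t := lt_of_lt_of_le (by positivity) ht1
  obtain ⟨hi, hhi, hhi'⟩ : ∃ hi ∈ A, t + 1 < ((hi : ℝ≥0) : ℝ) := by
    have h1 : ENNReal.ofReal (t + 1) < supA A := by simp [hsup]
    obtain ⟨b, hb⟩ := lt_iSup_iff.1 h1
    obtain ⟨hbA, hb⟩ := lt_iSup_iff.1 hb
    refine ⟨b, hbA, ?_⟩
    simpa using (ENNReal.ofReal_lt_iff_lt_toReal (by positivity) ENNReal.coe_ne_top).1 hb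
  have hK0 := zero_mem_of_mem_KSet hK.1
  obtain ⟨ω, hωF, hω⟩ := exists_config_hausdorffEDist_le (ε := ε) (h := t + 1) (R := 0) (s := 1)
    (ρ := -1) (q := 0) (C' := 0) K.isCompact hK0 ω₀ F hlo hhi hlol hhi'
    (by positivity) ht hδ (by linarith) hr₀ le_rfl one_pos le_rfl le_rfl hF
    (fun k hk => by
      obtain ⟨x, hx, hkx⟩ := Set.mem_iUnion₂.1 (hX hk)
      exact ⟨x, hx, (Metric.mem_ball.1 hkx).le⟩)
    hy0 hym hyK hyδ ht2 ht3
    (fun z hz => by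
      have h1 := infDist_smul_le (t := t) hK0 z
      rw [smul_zero, sub_zero] at h1
      linarith)
    (by rw [max_eq_right (by linarith)]; linarith) (by linarith) (Or.inl rfl)
    (fun _ _ h => absurd h (by norm_num))
    (fun x hx => by have := ht6 x hx; linarith)
  exact ⟨ω, hωF, hω.mono fun ω' h => ⟨t, ht1, h⟩⟩

/-- If `A` is bounded and accumulates at `0`, the high edges inside `(supA A)⁻¹` times the time
delay the exit from there, where the low tube starts, until the time is almost used up. -/
lemma exists_config_of_infA_eq_zero (hA : A.Nontrivial) (hinf : infA A = 0) (hsup : supA A ≠ ⊤)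
    {K : NonemptyCompacts (Space d)} (hK : K ∈ PSet d A) (ω₀ : Config d A)
    (F : Finset (lattice d).edgeSet) {ε : ℝ} (hε : 0 < ε) (n : ℕ) :
    ∃ ω : Config d A, (∀ e ∈ F, ω e = ω₀ e) ∧ ∀ᶠ ω' in 𝓝 ω, ∃ t : ℝ, n + 1 ≤ t ∧
      Metric.hausdorffEDist (t⁻¹ • B ω' t) (K : Set (Space d)) ≤ ENNReal.ofReal ε := by
  obtain ⟨r₀, hr₀, hF⟩ := exists_norm_emb_le F
  obtain ⟨X, hXK, hXfin, hX⟩ := K.isCompact.finite_cover_balls hε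
  obtain ⟨b, hb⟩ : ∃ b, b = (supA A).toReal := ⟨_, rfl⟩
  have hbA (a : ℝ≥0) (ha : a ∈ A) : (a : ℝ) ≤ b := by
    rw [hb, ← ENNReal.coe_toReal]
    exact ENNReal.toReal_mono hsup (le_iSup₂ (f := fun (a : ℝ≥0) (_ : a ∈ A) => (a : ℝ≥0∞)) a ha)
  have hb0 : 0 < b := by
    obtain ⟨a, ha, ha0⟩ := hA.exists_ne 0
    exact lt_of_lt_of_le (NNReal.coe_pos.2 (pos_iff_ne_zero.2 ha0)) (hbA a ha)
  -- With times in units of `t` and lengths in units of `t / b`: points of norm at most `ρ + δ` are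
  -- reached directly in time `1 - 3 * θ`, and the rest of a chain takes at most `θ`, whereas the
  -- potential at distance `s = 8 * θ` from the tube is about `(1 - θ) * (1 - 6 * θ + 8 * θ)`, which
  -- exceeds `1`.
  obtain ⟨θ, hθ⟩ : ∃ θ, θ = min (1 / 8) (ε * b / 16) := ⟨_, rfl⟩
  have hθ0 : 0 < θ := by rw [hθ]; positivity
  have hθ1 : θ ≤ 1 / 8 := hθ ▸ min_le_left _ _
  have hθε : 16 * (θ / b) ≤ ε := by
    have : θ ≤ ε * b / 16 := hθ ▸ min_le_right _ _
    rw [mul_div_assoc', div_le_iff₀ hb0]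
    linarith
  have hδ : 0 < θ / b := by positivity
  have hchain := fun (x : Space d) (hx : x ∈ X) => exists_chain hA.nonempty hK (hXK hx) hδ
  choose! m y hy0 hym hyK hyδ hyL using hchain
  obtain ⟨l, hal, hl⟩ := exists_gt_forall_mul_lt (a := (infA A).toReal) (κ := θ)
    (L := fun x => ∑ j ∈ Finset.range (m x), ‖y x j - y x (j + 1)‖) hXfin
    (fun x _ => by simpa [hinf] using hθ0)
  obtain ⟨lo, hlo, hlol⟩ := exists_mem_lt_of_infA_lt hA.nonempty hal
  obtain ⟨hi, hhi, hhi'⟩ : ∃ hi ∈ A, b * (1 - θ) < ((hi : ℝ≥0) : ℝ) := by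
    have h0 : 0 ≤ b * (1 - θ) := mul_nonneg hb0.le (by linarith)
    have h1 : ENNReal.ofReal (b * (1 - θ)) < supA A := by
      rw [ENNReal.ofReal_lt_iff_lt_toReal h0 hsup, ← hb]
      nlinarith
    obtain ⟨c, hc⟩ := lt_iSup_iff.1 h1
    obtain ⟨hcA, hc⟩ := lt_iSup_iff.1 hc
    refine ⟨c, hcA, ?_⟩
    simpa using (ENNReal.ofReal_lt_iff_lt_toReal h0 ENNReal.coe_ne_top).1 hc
  have hθb : 0 < (1 - 6 * θ) / b := div_pos (by linarith) hb0
  have hθ2 : 0 < θ / 2 := by positivity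
  obtain ⟨t, ⟨ht1, ht2, ht3, ht4, ht5⟩, ht6⟩ := ((((eventually_ge_atTop ((n : ℝ) + 1)).and
    ((eventually_le_const_mul (3 * d : ℝ) hδ).and ((eventually_le_const_mul r₀ hδ).and
    ((eventually_le_const_mul 1 hθb).and (eventually_le_const_mul (b * (1 + r₀)) hθ2))))).and
    ((eventually_all_finite hXfin).2 fun x hx => eventually_le_const_mul (b * (2 * d) +
      m x * (l * (2 * d) + ∑ e ∈ F, (((ω₀ e : ℝ≥0) : ℝ) + 1))) hθ0))).exists
  have ht : 0 < t := lt_of_lt_of_le (by positivity) ht1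
  have hK0 := zero_mem_of_mem_KSet hK.1
  obtain ⟨ω, hωF, hω⟩ := exists_config_hausdorffEDist_le (ε := ε) (h := b * (1 - θ))
    (R := (1 - 6 * θ) / b * t - 1) (s := 8 * (θ / b) * t) (ρ := (1 - 4 * θ) / b)
    (q := 1 - 3 * θ) (C' := b * (2 * d)) K.isCompact hK0 ω₀ F hlo hhi hlol hhi'
    (mul_nonneg hb0.le (by linarith)) ht hδ (by linarith) hr₀ (by linarith) (by positivity)
    (by linarith) (by positivity) hF
    (fun k hk => by
      obtain ⟨x, hx, hkx⟩ := Set.mem_iUnion₂.1 (hX hk)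
      exact ⟨x, hx, (Metric.mem_ball.1 hkx).le⟩)
    hy0 hym hyK hyδ ht2 ht3
    (fun z hz => by
      have hzK : t⁻¹ • z ∈ (K : Set (Space d)) := by
        apply hK.1.2.1
        have h1 : ‖t⁻¹ • z‖ ≤ b⁻¹ := by
          rw [norm_smul_of_nonneg (by positivity), inv_mul_le_iff₀ ht]
          calc ‖z‖ ≤ (1 - 6 * θ) / b * t := by linarith
            _ ≤ 1 / b * t := by gcongr; linarith
            _ = t * b⁻¹ := by rw [one_div, mul_comm]
        have h2 : (supA A)⁻¹ = ENNReal.ofReal b⁻¹ := by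
          rw [ENNReal.ofReal_inv_of_pos hb0, hb, ENNReal.ofReal_toReal hsup]
        change ‖t⁻¹ • z‖ₑ ≤ (supA A)⁻¹
        rw [h2, ← ofReal_norm]
        exact ENNReal.ofReal_le_ofReal h1
      have h1 := infDist_smul_le (t := t) hzK z
      rw [smul_inv_smul₀ ht.ne', sub_self, norm_zero] at h1
      exact h1.trans (by positivity))
    (by
      have h1 : b * (1 - θ) * ((1 - 6 * θ) / b * t - 1 - r₀ + 8 * (θ / b) * t) =
          (1 - θ) * (1 + 2 * θ) * t - (1 - θ) * (b * (1 + r₀)) := by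
        field_simp
        ring
      have h2 : (1 - θ) * (b * (1 + r₀)) ≤ θ / 2 * t :=
        (mul_le_of_le_one_left (by positivity) (by linarith)).trans ht5
      have h3 : 0 < θ * (1 / 2 - 2 * θ) * t := mul_pos (mul_pos hθ0 (by linarith)) ht
      calc t < (1 - θ) * (1 + 2 * θ) * t - (1 - θ) * (b * (1 + r₀)) := by nlinarith
        _ = b * (1 - θ) * ((1 - 6 * θ) / b * t - 1 - r₀ + 8 * (θ / b) * t) := h1.symm
        _ ≤ _ := by
          refine mul_le_mul_of_nonneg_left ?_ (mul_nonneg hb0.le (by linarith))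
          gcongr
          exact le_max_left _ _)
    (by nlinarith)
    (Or.inr (by
      have : ((1 - 4 * θ) / b - 2 * (θ / b)) * t = (1 - 6 * θ) / b * t := by ring
      rw [this]
      linarith))
    (fun ω z hρ hz => by
      refine (reach_of_fast_edges ω ∅ (fun _ => 0) (fun _ => le_rfl) (l := b)
        (r := t * ((1 - 3 * θ) / b) + 2 * d) hb0.le (by simp) ?_
        fun e _ _ => hbA _ (ω e).2).mono (le_of_eq ?_)
      · rw [zero_sub, norm_neg, norm_smul_of_nonneg ht.le]
        have : (1 - 4 * θ) / b + θ / b = (1 - 3 * θ) / b := by ring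
        rw [this] at hz
        gcongr
      · rw [Finset.sum_empty, add_zero]
        field_simp)
    (fun x hx => by
      have h1 := ht6 x hx
      have h2 := mul_le_mul_of_nonneg_left (hl x hx).le ht.le
      nlinarith)
  exact ⟨ω, hωF, hω.mono fun ω' h => ⟨t, ht1, h⟩⟩

/-- The configurations whose ball is close to `K` at some large time form a residual set, because
their interior is dense. -/
lemma eventually_residual_exists_hausdorffEDist_le (hA : A.Nontrivial)
    (hA' : infA A = 0 ∨ supA A = ⊤) {K : NonemptyCompacts (Space d)} (hK : K ∈ PSet d A)
    {ε : ℝ} (hε : 0 < ε) (n : ℕ) :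
    ∀ᶠ ω in residual (Config d A), ∃ t : ℝ, n + 1 ≤ t ∧
      Metric.hausdorffEDist (t⁻¹ • B ω t) (K : Set (Space d)) ≤ ENNReal.ofReal ε := by
  set U : Set (Config d A) := {ω | ∃ t : ℝ, n + 1 ≤ t ∧
      Metric.hausdorffEDist (t⁻¹ • B ω t) (K : Set (Space d)) ≤ ENNReal.ofReal ε} with hU
  have hdense : Dense (interior U) := by
    rw [dense_iff_inter_open]
    rintro V hV ⟨ω₀, hω₀⟩
    obtain ⟨F, u, hu, huV⟩ := isOpen_pi_iff.1 hV ω₀ hω₀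
    obtain ⟨ω, hωF, hω⟩ : ∃ ω : Config d A, (∀ e ∈ F, ω e = ω₀ e) ∧ ∀ᶠ ω' in 𝓝 ω, ω' ∈ U := by
      by_cases hsup : supA A = ⊤
      · exact exists_config_of_supA_eq_top hA.nonempty hsup hK ω₀ F hε n
      · exact exists_config_of_infA_eq_zero hA (hA'.resolve_right hsup) hsup hK ω₀ F hε n
    refine ⟨ω, huV fun e he => ?_, mem_interior_iff_mem_nhds.2 hω⟩
    rw [hωF e he]
    exact (hu e he).2
  exact mem_of_superset (residual_of_dense_open isOpen_interior hdense) interior_subset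

end FPP

theorem theorem1p5 (d : ℕ) (A : Set ℝ≥0) (hA : A.Nontrivial)
    (hA' : FPP.infA A = 0 ∨ FPP.supA A = ⊤) :
    ∀ᶠ ω in residual (FPP.Config d A), ∀ K ∈ FPP.PClosure d A,
      ∃ t : ℕ → ℝ, (∀ n, 0 < t n) ∧ Tendsto t atTop atTop ∧
        Tendsto (fun n => Metric.hausdorffEDist ((t n)⁻¹ • FPP.B ω (t n)) (K : Set (FPP.Space d)))
          atTop (𝓝 0) := by
  obtain ⟨Q, hQP, hQc, hQ⟩ :=
    (IsSeparable.of_separableSpace (FPP.PSet d A)).exists_countable_dense_subset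
  have hres : ∀ᶠ ω in residual (FPP.Config d A), ∀ K ∈ Q, ∀ n : ℕ, ∃ t : ℝ, n + 1 ≤ t ∧
      Metric.hausdorffEDist (t⁻¹ • FPP.B ω t) (K : Set (FPP.Space d)) ≤
        ENNReal.ofReal (1 / (n + 1)) := by
    rw [eventually_countable_ball hQc]
    intro K hK
    rw [eventually_countable_forall]
    intro n
    exact FPP.eventually_residual_exists_hausdorffEDist_le hA hA' (hQP hK) (by positivity) n
  filter_upwards [hres] with ω hω K hK
  have hKQ : K ∈ closure Q := closure_minimal hQ isClosed_closure hK.2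
  have h (n : ℕ) : ∃ t : ℝ, n + 1 ≤ t ∧
      Metric.hausdorffEDist (t⁻¹ • FPP.B ω t) (K : Set (FPP.Space d)) ≤
        ENNReal.ofReal (1 / (n + 1)) + ENNReal.ofReal (1 / (n + 1)) := by
    obtain ⟨K', hK'Q, hK'⟩ := EMetric.mem_closure_iff.1 hKQ (ENNReal.ofReal (1 / (n + 1)))
      (ENNReal.ofReal_pos.2 (by positivity))
    obtain ⟨t, ht, htK⟩ := hω K' hK'Q n
    refine ⟨t, ht, Metric.hausdorffEDist_triangle.trans (add_le_add htK ?_)⟩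
    rw [edist_comm] at hK'
    exact hK'.le
  choose t ht htK using h
  refine ⟨t, fun n => lt_of_lt_of_le (by positivity) (ht n), ?_, ?_⟩
  · refine tendsto_atTop_mono (fun n => ?_) tendsto_natCast_atTop_atTop
    linarith [ht n]
  · have h0 : Tendsto (fun n : ℕ => ENNReal.ofReal (1 / ((n : ℝ) + 1))) atTop (𝓝 0) := by
      rw [← ENNReal.ofReal_zero]
      exact ENNReal.tendsto_ofReal tendsto_one_div_add_atTop_nhds_zero_nat
    refine tendsto_of_tendsto_of_tendsto_of_le_of_le tendsto_const_nhds
      (by simpa using h0.add h0) (fun _ => zero_le) htK
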